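/- Let $A\in\mathbb{R}^{n\times n}$, $B\in\mathbb{R}^{n\times m}$, $G\in\mathbb{R}^{n\times q}$, and let $Q\succeq 0$ and $P_f\succeq 0$ (both $n\times n$) and $R\succ 0$ ($m\times m$) be real symmetric matrices such that $\mathcal{R}(G)\subseteq\mathcal{R}(B)$ and $G'P_fG\neq 0$. Let $\|\cdot\|$ denote the induced two-norm of a matrix. For a horizon $N\ge 1$ and a scalar $\lambda$ define, backwards from $\Pi_N(\lambda)=P_f$, for $k=N-1,\dots,0$, $$\Pi_k(\lambda)=Q+A'\Pi_{k+1}A-A'\Pi_{k+1}\begin{bmatrix}B&G\end{bmatrix}\begin{bmatrix}B'\Pi_{k+1}B+R & B'\Pi_{k+1}G\\ (B'\Pi_{k+1}G)' & G'\Pi_{k+1}G-\lambda I\end{bmatrix}^{-1}\begin{bmatrix}B'\\G'\end{bmatrix}\Pi_{k+1}A,\qquad \Pi_{k+1}=\Pi_{k+1}(\lambda).$$ Define the multiplier bounds by $\lambda_N=\|G'P_fG\|$ and, for $k=N-1,\dots,1$, $$\lambda_k=\begin{cases}\min\{\lambda\ge\lambda_{k+1}:\ \lambda=\|G'\Pi_k(\lambda)G\|\}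 & \text{if } \|G'\Pi_k(\lambda_{k+1})G\|>\lambda_{k+1},\\ \lambda_{k+1} & \text{otherwise.}\end{cases}$$ For $\alpha>0$ let $\mathcal{X}_L(\alpha,N)\subseteq\mathbb{R}^n$ be the set of all $x_0$ for which $\lambda=\lambda_1$ is optimal in $$\min_{\lambda\in[\lambda_1,\infty)}\ \frac12\Bigl(\frac{x_0}{\sqrt\alpha}\Bigr)'\Pi_0(\lambda)\Bigl(\frac{x_0}{\sqrt\alpha}\Bigr)+\frac{\lambda}{2},$$ and put $\mathcal{X}_L^\infty(\alpha)=\bigcap_{N=1}^\infty\mathcal{X}_L(\alpha,N)$ and $\mathcal{X}_{NL}^\infty(\alpha)=\mathbb{R}^n\setminus\mathcal{X}_L^\infty(\alpha)$. Then, for every $\alpha>0$, the set $\mathcal{X}_L^\infty(\alpha)$ contains $0$ (in particular it is nonempty), is closed and is convex; hence $\mathcal{X}_{NL}^\infty(\alpha)$ is open. -/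

import Mathlib

noncomputable section

namespace SiDAR

/-- The data of the regulation problem: dynamics `x⁺ = A x + B u + G w` with state in `ℝⁿ`,
control in `ℝᵐ` and disturbance in `ℝ^q`, stage cost `(1/2) x'Qx + (1/2) u'Ru` and terminal cost
`(1/2) x' Pf x`. The assumptions on the data are hypotheses of the theorem. -/
structure Plant (n m q : ℕ) where
  A : Matrix (Fin n) (Fin n) ℝ
  B : Matrix (Fin n) (Fin m) ℝ
  G : Matrix (Fin n) (Fin q) ℝ
  Q : Matrix (Fin n) (Fin n) ℝ
  R : Matrix (Fin m) (Fin m) ℝ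
  Pf : Matrix (Fin n) (Fin n) ℝ

/-- The induced two-norm of a square real matrix. -/
def twoNorm {q : ℕ} (M : Matrix (Fin q) (Fin q) ℝ) : ℝ :=
  ‖Matrix.toEuclideanCLM (n := Fin q) (𝕜 := ℝ) M‖

variable {n m q : ℕ}

/-- The block matrix `M(lam, P) = [B'PB + R, B'PG; (B'PG)', G'PG - lam I]`. -/
def blockM (S : Plant n m q) (lam : ℝ) (P : Matrix (Fin n) (Fin n) ℝ) :
    Matrix (Fin m ⊕ Fin q) (Fin m ⊕ Fin q) ℝ :=
  Matrix.fromBlocks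
    (S.B.transpose * P * S.B + S.R) (S.B.transpose * P * S.G)
    (S.B.transpose * P * S.G).transpose (S.G.transpose * P * S.G - lam • 1)

/-- One backward step `P ↦ Q + A'PA - A'P [B G] M(lam, P)⁻¹ [B'; G'] P A` of the Riccati
recursion. -/
def riccatiStep (S : Plant n m q) (lam : ℝ) (P : Matrix (Fin n) (Fin n) ℝ) :
    Matrix (Fin n) (Fin n) ℝ :=
  S.Q + S.A.transpose * P * S.A
    - S.A.transpose * P * Matrix.fromCols S.B S.G * (blockM S lam P)⁻¹
      * Matrix.fromRows S.B.transpose S.G.transpose * P * S.A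

/-- The value matrix with `j` stages to go: `P_0 = Pf` and `P_{j+1} = riccatiStep P_j`. -/
def valueToGo (S : Plant n m q) (lam : ℝ) : ℕ → Matrix (Fin n) (Fin n) ℝ
  | 0 => S.Pf
  | j + 1 => riccatiStep S lam (valueToGo S lam j)

/-- The stage matrix `Π_k(lam)` for horizon `N` (`k ≤ N`), so that `Π_N = Pf`. -/
def stagePi (S : Plant n m q) (N k : ℕ) (lam : ℝ) : Matrix (Fin n) (Fin n) ℝ :=
  valueToGo S lam (N - k)

/-- The multiplier lower bound with `j` stages to go: it starts at `‖G' Pf G‖`, and it is raised to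
the least `lam` above the previous bound with `lam = ‖G' P_{j+1}(lam) G‖` whenever
`‖G' P_{j+1} G‖` exceeds the previous bound at that bound. -/
def boundToGo (S : Plant n m q) : ℕ → ℝ
  | 0 => twoNorm (S.G.transpose * S.Pf * S.G)
  | j + 1 =>
    open Classical in
    if boundToGo S j
        < twoNorm (S.G.transpose * valueToGo S (boundToGo S j) (j + 1) * S.G) then
      sInf {lam : ℝ | boundToGo S j ≤ lam ∧
        lam = twoNorm (S.G.transpose * valueToGo S lam (j + 1) * S.G)}
    else boundToGo S j

/-- The multiplier lower bound `λ_k` for horizon `N` (`1 ≤ k ≤ N`), so that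
`λ_N = ‖G' Π_N G‖` and `λ_k` enforces `λ ≥ ‖G' Π_i(λ) G‖` for `i = k, …, N`. -/
def stageBound (S : Plant n m q) (N k : ℕ) : ℝ := boundToGo S (N - k)

/-- The objective `(1/2) (x₀/√α)' Π_0(lam) (x₀/√α) + lam/2` of the scalar problem for horizon
`N`. -/
def objective (S : Plant n m q) (α : ℝ) (N : ℕ) (x₀ : Fin n → ℝ) (lam : ℝ) : ℝ :=
  (1 / 2) * (((Real.sqrt α)⁻¹ • x₀) ⬝ᵥ
    Matrix.mulVec (stagePi S N 0 lam) ((Real.sqrt α)⁻¹ • x₀)) + lam / 2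

/-- The linear region for horizon `N`: the initial states for which `λ_1` is optimal in the
minimization of the objective over `[λ_1, ∞)`. -/
def regionL (S : Plant n m q) (α : ℝ) (N : ℕ) : Set (Fin n → ℝ) :=
  {x₀ | IsMinOn (objective S α N x₀) (Set.Ici (stageBound S N 1)) (stageBound S N 1)}

/-- The limit linear region, the intersection of the linear regions over all horizons `N ≥ 1`. -/
def limitRegionL (S : Plant n m q) (α : ℝ) : Set (Fin n → ℝ) :=
  ⋂ (N : ℕ) (_ : 1 ≤ N), regionL S α N

/-- The limit nonlinear region, the complement of the limit linear region. -/
def limitRegionNL (S : Plant n m q) (α : ℝ) : Set (Fin n → ℝ) :=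
  (limitRegionL S α)ᶜ

end SiDAR

end

namespace SiDAR

open Matrix

variable {n m q : ℕ}

/-! ### The induced two-norm on positive semidefinite matrices -/

/-! Optimality of `λ_1` says that, for every `λ ≥ λ_1`, the quadratic form of `Π_0(λ_1) - Π_0(λ)` at
`x₀/√α` is at most `λ - λ_1` (`regionL_eq_iInter`). Each such set is closed and contains 0, and it
is convex once the form is positive semidefinite. Hence everything rests on `Π_0` being antitone on
`[λ_1, ∞)`.

A Riccati step is the saddle value of a stage cost that increases with `P` and decreases with `λ`,
so it inherits both monotonicities (`riccatiStep_sub_posSemidef`). The saddle needs `G'PG ≤ λI` and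
a nonsingular block matrix. The multiplier bounds secure the first (`boundToGo_pos_and_regularOn`);
the range condition secures the second even at equality (`isUnit_det_blockM`). -/

theorem dotProduct_mulVec_le_twoNorm (X : Matrix (Fin q) (Fin q) ℝ) (w : Fin q → ℝ) :
    w ⬝ᵥ X *ᵥ w ≤ twoNorm X * (w ⬝ᵥ w) := by
  have h := inner_toEuclideanCLM X (WithLp.toLp 2 w) (WithLp.toLp 2 w)
  have hn : w ⬝ᵥ w = ‖WithLp.toLp 2 w‖ * ‖WithLp.toLp 2 w‖ := by
    rw [← real_inner_self_eq_norm_mul_norm, EuclideanSpace.inner_toLp_toLp, star_trivial]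
  change _ = w ⬝ᵥ X *ᵥ w at h
  rw [← h, hn, twoNorm]
  calc _ ≤ ‖WithLp.toLp 2 w‖ * ‖toEuclideanCLM (𝕜 := ℝ) X (WithLp.toLp 2 w)‖ :=
        real_inner_le_norm _ _
    _ ≤ ‖WithLp.toLp 2 w‖ * (‖toEuclideanCLM (𝕜 := ℝ) X‖ * ‖WithLp.toLp 2 w‖) := by
        gcongr; exact ContinuousLinearMap.le_opNorm _ _
    _ = _ := by ring

/-- The norm of a symmetric matrix is the supremum of its absolute Rayleigh quotients, and on
positive semidefinite matrices these respect the Loewner order. -/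
theorem twoNorm_le_of_posSemidef_sub {X Y : Matrix (Fin q) (Fin q) ℝ}
    (hX : X.PosSemidef) (hXY : (Y - X).PosSemidef) : twoNorm X ≤ twoNorm Y := by
  have hsym : (toEuclideanCLM (n := Fin q) (𝕜 := ℝ) X).IsSymmetric :=
    isSymmetric_toEuclideanLin_iff.mpr hX.isHermitian
  rw [twoNorm, ContinuousLinearMap.norm_eq_iSup_rayleighQuotient _ hsym]
  refine ciSup_le fun v => ?_
  refine le_trans ?_ (ContinuousLinearMap.rayleighQuotient_le_norm
    (toEuclideanCLM (n := Fin q) (𝕜 := ℝ) Y) v)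
  have key (Z : Matrix (Fin q) (Fin q) ℝ) :
      (toEuclideanCLM (n := Fin q) (𝕜 := ℝ) Z).rayleighQuotient v
        = (v ⬝ᵥ Z *ᵥ v) / ‖v‖ ^ 2 := by
    rw [ContinuousLinearMap.rayleighQuotient, ContinuousLinearMap.reApplyInnerSelf_apply,
      real_inner_comm, inner_toEuclideanCLM]
    rfl
  have h0 : 0 ≤ v ⬝ᵥ X *ᵥ v := hX.dotProduct_mulVec_nonneg v
  have h1 : 0 ≤ v ⬝ᵥ (Y - X) *ᵥ v := hXY.dotProduct_mulVec_nonneg v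
  rw [sub_mulVec, dotProduct_sub] at h1
  rw [key, key, abs_of_nonneg (by positivity)]
  refine le_trans ?_ (le_abs_self _)
  gcongr
  linarith

theorem continuous_twoNorm : Continuous (twoNorm (q := q)) :=
  ((toEuclideanCLM (n := Fin q) (𝕜 := ℝ)).toAlgEquiv.toLinearEquiv.toLinearMap
    |>.continuous_of_finiteDimensional).norm

theorem twoNorm_pos {X : Matrix (Fin q) (Fin q) ℝ} (hX : X ≠ 0) : 0 < twoNorm X := by
  rw [twoNorm, norm_pos_iff]
  exact (map_ne_zero_iff _ (toEuclideanCLM (n := Fin q) (𝕜 := ℝ)).injective).mpr hX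

/-! ### The saddle point of one stage -/

/-- Twice the cost of one stage with terminal weight `P` and penalty `lam` on the disturbance. -/
def stageCost (S : Plant n m q) (lam : ℝ) (P : Matrix (Fin n) (Fin n) ℝ)
    (x : Fin n → ℝ) (u : Fin m → ℝ) (w : Fin q → ℝ) : ℝ :=
  x ⬝ᵥ S.Q *ᵥ x + u ⬝ᵥ S.R *ᵥ u
    + (S.A *ᵥ x + S.B *ᵥ u + S.G *ᵥ w) ⬝ᵥ P *ᵥ (S.A *ᵥ x + S.B *ᵥ u + S.G *ᵥ w)
    - lam * (w ⬝ᵥ w)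

/-- `P` is admissible at level `lam`: it is positive semidefinite and the stage cost is concave in
the disturbance. -/
structure Admissible (S : Plant n m q) (lam : ℝ) (P : Matrix (Fin n) (Fin n) ℝ) : Prop where
  posSemidef : P.PosSemidef
  twoNorm_le : twoNorm (S.G.transpose * P * S.G) ≤ lam

theorem transpose_mul_mul_dotProduct {k l : ℕ} (C : Matrix (Fin n) (Fin k) ℝ)
    (P : Matrix (Fin n) (Fin n) ℝ) (D : Matrix (Fin n) (Fin l) ℝ) (u : Fin k → ℝ)
    (v : Fin l → ℝ) :
    u ⬝ᵥ (C.transpose * P * D) *ᵥ v = (C *ᵥ u) ⬝ᵥ P *ᵥ (D *ᵥ v) := by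
  rw [← mulVec_mulVec, ← mulVec_mulVec, dotProduct_mulVec, vecMul_transpose]

theorem dotProduct_mulVec_comm_of_isSymm {ι : Type*} [Fintype ι] {P : Matrix ι ι ℝ}
    (hP : P.transpose = P) (a b : ι → ℝ) : a ⬝ᵥ P *ᵥ b = b ⬝ᵥ P *ᵥ a := by
  rw [dotProduct_mulVec, ← mulVec_transpose, hP, dotProduct_comm]

theorem _root_.Matrix.PosSemidef.transpose_eq {ι : Type*} {P : Matrix ι ι ℝ}
    (hP : P.PosSemidef) : P.transpose = P := by
  simpa [Matrix.IsHermitian, conjTranspose_eq_transpose_of_trivial] using hP.isHermitian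

theorem Admissible.dotProduct_le {S : Plant n m q} {lam : ℝ} {P : Matrix (Fin n) (Fin n) ℝ}
    (h : Admissible S lam P) (w : Fin q → ℝ) :
    (S.G *ᵥ w) ⬝ᵥ P *ᵥ (S.G *ᵥ w) ≤ lam * (w ⬝ᵥ w) := by
  rw [← transpose_mul_mul_dotProduct]
  refine (dotProduct_mulVec_le_twoNorm _ w).trans ?_
  have : 0 ≤ w ⬝ᵥ w := by simpa using dotProduct_star_self_nonneg w
  exact mul_le_mul_of_nonneg_right h.twoNorm_le this

theorem dotProduct_blockM_mulVec (S : Plant n m q) (lam : ℝ) {P : Matrix (Fin n) (Fin n) ℝ}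
    (hP : P.transpose = P) (u : Fin m → ℝ) (w : Fin q → ℝ) :
    Sum.elim u w ⬝ᵥ blockM S lam P *ᵥ Sum.elim u w
      = u ⬝ᵥ S.R *ᵥ u + (S.B *ᵥ u + S.G *ᵥ w) ⬝ᵥ P *ᵥ (S.B *ᵥ u + S.G *ᵥ w)
        - lam * (w ⬝ᵥ w) := by
  have ht : (S.B.transpose * P * S.G).transpose = S.G.transpose * P * S.B := by
    simp [transpose_mul, hP, Matrix.mul_assoc]
  rw [blockM, ht, fromBlocks_mulVec, sumElim_dotProduct_sumElim]
  simp only [add_mulVec, sub_mulVec, smul_mulVec, one_mulVec, dotProduct_add, dotProduct_sub,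
    dotProduct_smul, smul_eq_mul, transpose_mul_mul_dotProduct, Sum.elim_comp_inl,
    Sum.elim_comp_inr, mulVec_add, add_dotProduct]
  ring

theorem blockM_transpose {S : Plant n m q} (hR : S.R.PosDef) (lam : ℝ)
    {P : Matrix (Fin n) (Fin n) ℝ} (hP : P.transpose = P) :
    (blockM S lam P).transpose = blockM S lam P := by
  simp [blockM, fromBlocks_transpose, transpose_mul, hP, hR.posSemidef.transpose_eq,
    Matrix.mul_assoc]

/-- The range condition makes the block matrix nonsingular up to and including the threshold
`lam = ‖G'PG‖`. -/
theorem isUnit_det_blockM {S : Plant n m q} (hR : S.R.PosDef)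
    (hrange : LinearMap.range S.G.mulVecLin ≤ LinearMap.range S.B.mulVecLin)
    {lam : ℝ} (hlam : 0 < lam) {P : Matrix (Fin n) (Fin n) ℝ} (hP : Admissible S lam P) :
    IsUnit (blockM S lam P).det := by
  rw [isUnit_iff_ne_zero]
  intro hdet
  obtain ⟨z, hz0, hz⟩ := exists_mulVec_eq_zero_iff.mpr hdet
  obtain ⟨u, w, rfl⟩ : ∃ u w, z = Sum.elim u w := ⟨_, _, (Sum.elim_comp_inl_inr z).symm⟩
  have hPt := hP.posSemidef.transpose_eq
  have ht : (S.B.transpose * P * S.G).transpose = S.G.transpose * P * S.B := by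
    simp [transpose_mul, hPt, Matrix.mul_assoc]
  rw [blockM, ht, fromBlocks_mulVec, Sum.elim_comp_inl, Sum.elim_comp_inr] at hz
  have hz₁ := congrArg (· ∘ Sum.inl) hz
  have hz₂ := congrArg (· ∘ Sum.inr) hz
  simp only [Sum.elim_comp_inl, Sum.elim_comp_inr] at hz₁ hz₂
  have test₁ (v : Fin m → ℝ) : (S.B *ᵥ v) ⬝ᵥ P *ᵥ (S.B *ᵥ u) + v ⬝ᵥ S.R *ᵥ u
      + (S.B *ᵥ v) ⬝ᵥ P *ᵥ (S.G *ᵥ w) = 0 := by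
    have := congrArg (v ⬝ᵥ ·) hz₁
    simpa only [add_mulVec, dotProduct_add, transpose_mul_mul_dotProduct,
      show (0 : Fin m ⊕ Fin q → ℝ) ∘ Sum.inl = 0 from rfl, dotProduct_zero] using this
  have test₂ : (S.G *ᵥ w) ⬝ᵥ P *ᵥ (S.B *ᵥ u)
      + ((S.G *ᵥ w) ⬝ᵥ P *ᵥ (S.G *ᵥ w) - lam * (w ⬝ᵥ w)) = 0 := by
    have := congrArg (w ⬝ᵥ ·) hz₂
    simpa only [sub_mulVec, dotProduct_add, dotProduct_sub, transpose_mul_mul_dotProduct,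
      smul_mulVec, one_mulVec, dotProduct_smul, smul_eq_mul,
      show (0 : Fin m ⊕ Fin q → ℝ) ∘ Sum.inr = 0 from rfl, dotProduct_zero] using this
  have hsymm := dotProduct_mulVec_comm_of_isSymm hPt (S.G *ᵥ w) (S.B *ᵥ u)
  have hBu : 0 ≤ (S.B *ᵥ u) ⬝ᵥ P *ᵥ (S.B *ᵥ u) := hP.posSemidef.dotProduct_mulVec_nonneg _
  -- Subtracting `test₂` from `test₁ u` cancels the cross terms and leaves a vanishing sum of
  -- nonnegative terms, one of them `u'Ru`.
  have hu : u = 0 := by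
    by_contra hu
    have hpos : 0 < u ⬝ᵥ S.R *ᵥ u := hR.dotProduct_mulVec_pos hu
    linarith [test₁ u, hP.dotProduct_le w]
  subst hu
  -- With `Bv = Gw`, the first block row tested against `v` gives `(Gw)'P(Gw) = 0`; the second then
  -- leaves `λ w'w = 0`.
  obtain ⟨v, hv⟩ := hrange ⟨w, rfl⟩
  simp only [mulVecLin_apply] at hv
  have hv₁ := test₁ v
  simp only [mulVec_zero, dotProduct_zero, zero_add, hv] at hv₁ test₂
  have hw : w ⬝ᵥ w = 0 := by
    have : lam * (w ⬝ᵥ w) = 0 := by linarith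
    exact (mul_eq_zero.mp this).resolve_left hlam.ne'
  rw [dotProduct_self_eq_zero] at hw
  subst hw
  exact hz0 (by ext i; cases i <;> rfl)

theorem riccatiStep_transpose {S : Plant n m q} (hQ : S.Q.PosSemidef) (hR : S.R.PosDef)
    (lam : ℝ) {P : Matrix (Fin n) (Fin n) ℝ} (hP : P.transpose = P) :
    (riccatiStep S lam P).transpose = riccatiStep S lam P := by
  simp [riccatiStep, transpose_mul, transpose_nonsing_inv, blockM_transpose hR lam hP, hP,
    hQ.transpose_eq, Matrix.mul_assoc, transpose_fromCols, transpose_fromRows]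

/-- Completing the square in the stage cost. -/
theorem stageCost_eq_riccatiStep_add {S : Plant n m q} (hR : S.R.PosDef) {lam : ℝ}
    {P : Matrix (Fin n) (Fin n) ℝ} (hP : P.transpose = P)
    (hM : IsUnit (blockM S lam P).det) (x : Fin n → ℝ) :
    ∃ u₀ w₀, ∀ u w, stageCost S lam P x u w
      = x ⬝ᵥ riccatiStep S lam P *ᵥ x
        + Sum.elim (u - u₀) (w - w₀) ⬝ᵥ blockM S lam P *ᵥ Sum.elim (u - u₀) (w - w₀) := by
  set M := blockM S lam P with hMdef
  set c := fromRows S.B.transpose S.G.transpose *ᵥ (P *ᵥ (S.A *ᵥ x)) with hc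
  obtain ⟨z₀, hz₀⟩ : ∃ z, z = -(M⁻¹ *ᵥ c) := ⟨_, rfl⟩
  refine ⟨z₀ ∘ Sum.inl, z₀ ∘ Sum.inr, fun u w => ?_⟩
  have hsub : Sum.elim (u - z₀ ∘ Sum.inl) (w - z₀ ∘ Sum.inr) = Sum.elim u w - z₀ := by
    ext i; cases i <;> rfl
  -- `z₀` is the stationary point of the stage cost in `(u, w)`.
  have hMz : M *ᵥ z₀ = -c := by
    rw [hz₀, mulVec_neg, mulVec_mulVec, mul_nonsing_inv _ hM, one_mulVec]
  have hMt : M.transpose = M := blockM_transpose hR lam hP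
  have hval : x ⬝ᵥ riccatiStep S lam P *ᵥ x
      = x ⬝ᵥ S.Q *ᵥ x + (S.A *ᵥ x) ⬝ᵥ P *ᵥ (S.A *ᵥ x) + c ⬝ᵥ z₀ := by
    have hcols : x ⬝ᵥ (S.A.transpose * P * fromCols S.B S.G * M⁻¹
        * fromRows S.B.transpose S.G.transpose * P * S.A) *ᵥ x = c ⬝ᵥ M⁻¹ *ᵥ c := by
      have hrow : fromCols S.B S.G = (fromRows S.B.transpose S.G.transpose).transpose := by
        rw [transpose_fromRows, transpose_transpose, transpose_transpose]
      rw [hrow]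
      simp only [← mulVec_mulVec]
      rw [dotProduct_mulVec, vecMul_transpose, dotProduct_mulVec, ← mulVec_transpose, hP,
        dotProduct_mulVec, vecMul_transpose]
    rw [riccatiStep, sub_mulVec, add_mulVec, dotProduct_sub, dotProduct_add,
      transpose_mul_mul_dotProduct, hcols, hz₀, dotProduct_neg]
    ring
  have hlin : Sum.elim u w ⬝ᵥ c
      = (S.B *ᵥ u + S.G *ᵥ w) ⬝ᵥ P *ᵥ (S.A *ᵥ x) := by
    rw [hc, fromRows_mulVec, sumElim_dotProduct_sumElim, dotProduct_mulVec u, dotProduct_mulVec w,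
      vecMul_transpose, vecMul_transpose, add_dotProduct]
  have hquad := dotProduct_blockM_mulVec S lam hP u w
  rw [← hMdef] at hquad
  rw [hsub, hval, mulVec_sub, hMz, sub_neg_eq_add, dotProduct_add, sub_dotProduct,
    sub_dotProduct, dotProduct_mulVec_comm_of_isSymm hMt z₀, hMz, dotProduct_neg,
    hlin, dotProduct_comm z₀ c, hquad, stageCost, add_assoc (S.A *ᵥ x)]
  set y := S.B *ᵥ u + S.G *ᵥ w
  rw [mulVec_add, add_dotProduct, dotProduct_add, dotProduct_add,
    dotProduct_mulVec_comm_of_isSymm hP (S.A *ᵥ x) y]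
  ring

/-- The Riccati step is the value of the saddle point of the stage cost. -/
theorem exists_saddle_riccatiStep {S : Plant n m q} (hR : S.R.PosDef)
    (hrange : LinearMap.range S.G.mulVecLin ≤ LinearMap.range S.B.mulVecLin)
    {lam : ℝ} (hlam : 0 < lam) {P : Matrix (Fin n) (Fin n) ℝ} (hP : Admissible S lam P)
    (x : Fin n → ℝ) :
    ∃ u₀ w₀, (∀ w, stageCost S lam P x u₀ w ≤ x ⬝ᵥ riccatiStep S lam P *ᵥ x) ∧
      ∀ u, x ⬝ᵥ riccatiStep S lam P *ᵥ x ≤ stageCost S lam P x u w₀ := by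
  have hPt := hP.posSemidef.transpose_eq
  obtain ⟨u₀, w₀, h⟩ := stageCost_eq_riccatiStep_add hR hPt
    (isUnit_det_blockM hR hrange hlam hP) x
  refine ⟨u₀, w₀, fun w => ?_, fun u => ?_⟩
  · rw [h, dotProduct_blockM_mulVec S lam hPt]
    have := hP.dotProduct_le (w - w₀)
    simp only [sub_self, mulVec_zero, zero_add, dotProduct_zero]
    linarith
  · rw [h, dotProduct_blockM_mulVec S lam hPt]
    have h₁ : 0 ≤ (u - u₀) ⬝ᵥ S.R *ᵥ (u - u₀) :=
      hR.posSemidef.dotProduct_mulVec_nonneg _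
    have h₂ : 0 ≤ (S.B *ᵥ (u - u₀)) ⬝ᵥ P *ᵥ (S.B *ᵥ (u - u₀)) :=
      hP.posSemidef.dotProduct_mulVec_nonneg _
    simp only [sub_self, mulVec_zero, add_zero, dotProduct_zero, mul_zero, sub_zero]
    linarith

theorem riccatiStep_posSemidef {S : Plant n m q} (hQ : S.Q.PosSemidef) (hR : S.R.PosDef)
    (hrange : LinearMap.range S.G.mulVecLin ≤ LinearMap.range S.B.mulVecLin)
    {lam : ℝ} (hlam : 0 < lam) {P : Matrix (Fin n) (Fin n) ℝ} (hP : Admissible S lam P) :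
    (riccatiStep S lam P).PosSemidef := by
  refine .of_dotProduct_mulVec_nonneg ?_ fun x => ?_
  · rw [Matrix.IsHermitian, conjTranspose_eq_transpose_of_trivial]
    exact riccatiStep_transpose hQ hR lam hP.posSemidef.transpose_eq
  · obtain ⟨u₀, -, h, -⟩ := exists_saddle_riccatiStep hR hrange hlam hP x
    -- The saddle value dominates the cost of zero disturbance, which is nonnegative.
    refine le_trans ?_ (h 0)
    have h₁ : 0 ≤ x ⬝ᵥ S.Q *ᵥ x := hQ.dotProduct_mulVec_nonneg _
    have h₂ : 0 ≤ u₀ ⬝ᵥ S.R *ᵥ u₀ := hR.posSemidef.dotProduct_mulVec_nonneg _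
    have h₃ : 0 ≤ (S.A *ᵥ x + S.B *ᵥ u₀) ⬝ᵥ P *ᵥ (S.A *ᵥ x + S.B *ᵥ u₀) :=
      hP.posSemidef.dotProduct_mulVec_nonneg _
    simp only [stageCost, mulVec_zero, add_zero, dotProduct_zero, mul_zero, sub_zero]
    linarith

theorem riccatiStep_sub_posSemidef {S : Plant n m q} (hQ : S.Q.PosSemidef) (hR : S.R.PosDef)
    (hrange : LinearMap.range S.G.mulVecLin ≤ LinearMap.range S.B.mulVecLin)
    {lam mu : ℝ} (hlam : 0 < lam) (hle : lam ≤ mu) {P P' : Matrix (Fin n) (Fin n) ℝ}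
    (hP : Admissible S lam P) (hP' : Admissible S mu P') (hsub : (P - P').PosSemidef) :
    (riccatiStep S lam P - riccatiStep S mu P').PosSemidef := by
  refine .of_dotProduct_mulVec_nonneg ?_ fun x => ?_
  · rw [Matrix.IsHermitian, conjTranspose_eq_transpose_of_trivial, transpose_sub,
      riccatiStep_transpose hQ hR lam hP.posSemidef.transpose_eq,
      riccatiStep_transpose hQ hR mu hP'.posSemidef.transpose_eq]
  · obtain ⟨u₀, -, h, -⟩ := exists_saddle_riccatiStep hR hrange hlam hP x
    obtain ⟨-, w₀, -, h'⟩ := exists_saddle_riccatiStep hR hrange (hlam.trans_le hle) hP' x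
    have hw : 0 ≤ w₀ ⬝ᵥ w₀ := by simpa using dotProduct_star_self_nonneg w₀
    -- The two problems are compared at a mixed pair: the control is optimal for `(lam, P)`, the
    -- disturbance for `(mu, P')`.
    have hmid : stageCost S mu P' x u₀ w₀ ≤ stageCost S lam P x u₀ w₀ := by
      simp only [stageCost]
      set y := S.A *ᵥ x + S.B *ᵥ u₀ + S.G *ᵥ w₀
      have hy : 0 ≤ y ⬝ᵥ (P - P') *ᵥ y := hsub.dotProduct_mulVec_nonneg y
      rw [sub_mulVec, dotProduct_sub] at hy
      linarith [mul_le_mul_of_nonneg_right hle hw]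
    have := (h' u₀).trans (hmid.trans (h w₀))
    simpa [sub_mulVec, dotProduct_sub] using this

theorem continuousOn_riccatiStep {S : Plant n m q} {s : Set ℝ}
    {P : ℝ → Matrix (Fin n) (Fin n) ℝ} (hP : ContinuousOn P s)
    (hM : ∀ lam ∈ s, IsUnit (blockM S lam (P lam)).det) :
    ContinuousOn (fun lam => riccatiStep S lam (P lam)) s := by
  rw [continuousOn_iff_continuous_domRestrict] at hP ⊢
  have hP' : Continuous fun lam : s => P lam := hP
  have hquad {k l : ℕ} (C : Matrix (Fin n) (Fin k) ℝ) (D : Matrix (Fin n) (Fin l) ℝ) :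
      Continuous fun lam : s => C.transpose * P lam * D :=
    (continuous_const.matrix_mul hP').matrix_mul continuous_const
  have hblock : Continuous fun lam : s => blockM S lam (P lam) :=
    Continuous.matrix_fromBlocks ((hquad _ _).add continuous_const) (hquad _ _)
      (hquad _ _).matrix_transpose
      ((hquad _ _).sub (continuous_subtype_val.smul continuous_const))
  have hinv : Continuous fun lam : s => (blockM S lam (P lam))⁻¹ := by
    rw [continuous_iff_continuousAt]
    intro lam
    refine ContinuousAt.comp (g := Inv.inv) (continuousAt_matrix_inv _ ?_) hblock.continuousAt
    rw [Ring.inverse_eq_inv']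
    exact continuousAt_inv₀ (hM lam lam.2).ne_zero
  exact (continuous_const.add (hquad _ _)).sub
    ((((((continuous_const.matrix_mul hP').matrix_mul continuous_const).matrix_mul
      hinv).matrix_mul continuous_const).matrix_mul hP').matrix_mul continuous_const)

/-! ### The multiplier bounds -/

/-- The properties of a family of value matrices on a half-line of multipliers that the Riccati
recursion preserves. -/
structure RegularOn (P : ℝ → Matrix (Fin n) (Fin n) ℝ) (s : Set ℝ) : Prop where
  posSemidef : ∀ lam ∈ s, (P lam).PosSemidef
  antitone : ∀ lam ∈ s, ∀ mu ∈ s, lam ≤ mu → (P lam - P mu).PosSemidef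
  continuousOn : ContinuousOn P s

theorem RegularOn.mono {P : ℝ → Matrix (Fin n) (Fin n) ℝ} {s t : Set ℝ}
    (h : RegularOn P t) (hst : s ⊆ t) : RegularOn P s where
  posSemidef lam hlam := h.posSemidef lam (hst hlam)
  antitone lam hlam mu hmu := h.antitone lam (hst hlam) mu (hst hmu)
  continuousOn := h.continuousOn.mono hst

theorem RegularOn.riccatiStep {S : Plant n m q} (hQ : S.Q.PosSemidef) (hR : S.R.PosDef)
    (hrange : LinearMap.range S.G.mulVecLin ≤ LinearMap.range S.B.mulVecLin)
    {P : ℝ → Matrix (Fin n) (Fin n) ℝ} {s : Set ℝ} (hs : ∀ lam ∈ s, 0 < lam)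
    (h : RegularOn P s) (hle : ∀ lam ∈ s, twoNorm (S.G.transpose * P lam * S.G) ≤ lam) :
    RegularOn (fun lam => riccatiStep S lam (P lam)) s := by
  have hadm : ∀ lam ∈ s, Admissible S lam (P lam) :=
    fun lam hlam => ⟨h.posSemidef lam hlam, hle lam hlam⟩
  exact
    { posSemidef := fun lam hlam =>
        riccatiStep_posSemidef hQ hR hrange (hs lam hlam) (hadm lam hlam)
      antitone := fun lam hlam mu hmu hlm =>
        riccatiStep_sub_posSemidef hQ hR hrange (hs lam hlam) hlm (hadm lam hlam) (hadm mu hmu)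
          (h.antitone lam hlam mu hmu hlm)
      continuousOn := continuousOn_riccatiStep h.continuousOn fun lam hlam =>
        isUnit_det_blockM hR hrange (hs lam hlam) (hadm lam hlam) }

theorem RegularOn.antitoneOn_twoNorm {P : ℝ → Matrix (Fin n) (Fin n) ℝ} {s : Set ℝ}
    (h : RegularOn P s) (G : Matrix (Fin n) (Fin q) ℝ) :
    AntitoneOn (fun lam => twoNorm (G.transpose * P lam * G)) s := by
  intro lam hlam mu hmu hle
  refine twoNorm_le_of_posSemidef_sub ?_ ?_
  · simpa [conjTranspose_eq_transpose_of_trivial] using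
      (h.posSemidef mu hmu).conjTranspose_mul_mul_same G
  · simpa [conjTranspose_eq_transpose_of_trivial, Matrix.mul_sub, Matrix.sub_mul] using
      (h.antitone lam hlam mu hmu hle).conjTranspose_mul_mul_same G

theorem RegularOn.continuousOn_twoNorm {P : ℝ → Matrix (Fin n) (Fin n) ℝ} {s : Set ℝ}
    (h : RegularOn P s) (G : Matrix (Fin n) (Fin q) ℝ) :
    ContinuousOn (fun lam => twoNorm (G.transpose * P lam * G)) s := by
  have hc : Continuous fun X : Matrix (Fin n) (Fin n) ℝ => twoNorm (G.transpose * X * G) :=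
    continuous_twoNorm.comp
      ((continuous_const.matrix_mul continuous_id).matrix_mul continuous_const)
  exact hc.comp_continuousOn h.continuousOn

/-- A continuous antitone function on `[b, ∞)` that starts above the diagonal meets it exactly
once. -/
theorem existsUnique_fixedPoint_of_antitoneOn {f : ℝ → ℝ} {b : ℝ}
    (hcont : ContinuousOn f (Set.Ici b)) (hanti : AntitoneOn f (Set.Ici b)) (hb : b < f b) :
    ∃ c, b ≤ c ∧ {lam | b ≤ lam ∧ lam = f lam} = {c} := by
  have hsub : Set.Icc b (f b) ⊆ Set.Ici b := Set.Icc_subset_Ici_self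
  have hcont' : ContinuousOn (fun lam => f lam - lam) (Set.Icc b (f b)) :=
    (hcont.mono hsub).sub continuousOn_id
  -- `f b` serves as the right endpoint, where the graph has fallen to or below the diagonal.
  have hfb : f (f b) ≤ f b := hanti Set.self_mem_Ici hb.le hb.le
  obtain ⟨c, hc, hc0⟩ := intermediate_value_Icc' hb.le hcont'
    (show (0 : ℝ) ∈ Set.Icc _ _ from ⟨by linarith, by linarith⟩)
  have hfix : c = f c := by simp only at hc0; linarith
  refine ⟨c, hc.1, Set.eq_singleton_iff_unique_mem.mpr ⟨⟨hc.1, hfix⟩, fun d hd => ?_⟩⟩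
  rcases le_total c d with h | h
  · have := hanti hc.1 hd.1 h
    linarith [hd.2]
  · have := hanti hd.1 hc.1 h
    linarith [hd.2]

/-- The norm falls as `lam` grows, so the inequality need only be checked at the new bound. When the
bound is raised, the infimum is over a singleton. -/
theorem boundToGo_le_succ_and_twoNorm_le {S : Plant n m q} {j : ℕ}
    (h : RegularOn (fun lam => valueToGo S lam (j + 1)) (Set.Ici (boundToGo S j))) :
    boundToGo S j ≤ boundToGo S (j + 1) ∧ ∀ lam ∈ Set.Ici (boundToGo S (j + 1)),
      twoNorm (S.G.transpose * valueToGo S lam (j + 1) * S.G) ≤ lam := by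
  have hanti := h.antitoneOn_twoNorm S.G
  suffices ∃ c, boundToGo S (j + 1) = c ∧ boundToGo S j ≤ c ∧
      twoNorm (S.G.transpose * valueToGo S c (j + 1) * S.G) ≤ c by
    obtain ⟨c, hc, hjc, hle⟩ := this
    refine ⟨hc ▸ hjc, fun lam hlam => ?_⟩
    rw [hc] at hlam
    exact (hanti hjc (hjc.trans hlam) hlam).trans (hle.trans hlam)
  rw [boundToGo]
  split_ifs with hlt
  · obtain ⟨c, hc, hset⟩ :=
      existsUnique_fixedPoint_of_antitoneOn (h.continuousOn_twoNorm S.G) hanti hlt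
    refine ⟨c, by rw [hset, csInf_singleton], hc, ?_⟩
    have hmem : c ∈ {lam | boundToGo S j ≤ lam ∧
        lam = twoNorm (S.G.transpose * valueToGo S lam (j + 1) * S.G)} := hset ▸ rfl
    exact hmem.2.ge
  · exact ⟨_, rfl, le_rfl, not_lt.mp hlt⟩

/-- The claims need a joint induction: positivity and the norm bound keep the next Riccati step
regular on the old half-line, and this regularity controls the next bound. -/
theorem boundToGo_pos_and_regularOn {S : Plant n m q}
    (hQ : S.Q.PosSemidef) (hR : S.R.PosDef) (hPf : S.Pf.PosSemidef)
    (hrange : LinearMap.range S.G.mulVecLin ≤ LinearMap.range S.B.mulVecLin)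
    (hG : S.G.transpose * S.Pf * S.G ≠ 0) (j : ℕ) :
    0 < boundToGo S j ∧
    RegularOn (fun lam => valueToGo S lam j) (Set.Ici (boundToGo S j)) ∧
    ∀ lam ∈ Set.Ici (boundToGo S j),
      twoNorm (S.G.transpose * valueToGo S lam j * S.G) ≤ lam := by
  induction j with
  | zero =>
    refine ⟨twoNorm_pos hG, ⟨fun _ _ => hPf, fun _ _ _ _ _ => ?_, continuousOn_const⟩,
      fun lam hlam => hlam⟩
    simpa [valueToGo] using PosSemidef.zero
  | succ j ih =>
    obtain ⟨hpos, hreg, hle⟩ := ih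
    have hnext : RegularOn (fun lam => valueToGo S lam (j + 1)) (Set.Ici (boundToGo S j)) :=
      hreg.riccatiStep hQ hR hrange (fun lam hlam => hpos.trans_le hlam) hle
    obtain ⟨hmono, hle'⟩ := boundToGo_le_succ_and_twoNorm_le hnext
    exact ⟨hpos.trans_le hmono, hnext.mono (Set.Ici_subset_Ici.mpr hmono), hle'⟩

/-- `Π_0` is antitone on `[λ_1, ∞)`. -/
theorem stagePi_zero_sub_posSemidef {S : Plant n m q}
    (hQ : S.Q.PosSemidef) (hR : S.R.PosDef) (hPf : S.Pf.PosSemidef)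
    (hrange : LinearMap.range S.G.mulVecLin ≤ LinearMap.range S.B.mulVecLin)
    (hG : S.G.transpose * S.Pf * S.G ≠ 0) {N : ℕ} (hN : 1 ≤ N) {lam : ℝ}
    (hlam : stageBound S N 1 ≤ lam) :
    (stagePi S N 0 (stageBound S N 1) - stagePi S N 0 lam).PosSemidef := by
  -- For horizon `j + 1`, `λ_1` has `j` stages to go and `Π_0` has `j + 1`; no norm bound on `Π_0`
  -- itself is needed.
  obtain ⟨j, rfl⟩ : ∃ j, N = j + 1 := ⟨N - 1, by omega⟩
  obtain ⟨hpos, hreg, hle⟩ := boundToGo_pos_and_regularOn hQ hR hPf hrange hG j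
  exact (hreg.riccatiStep hQ hR hrange (fun lam hlam => hpos.trans_le hlam) hle).antitone
    _ Set.self_mem_Ici _ hlam hlam

/-! ### The linear region -/

theorem convexOn_dotProduct_mulVec {D : Matrix (Fin n) (Fin n) ℝ} (hD : D.PosSemidef) :
    ConvexOn ℝ Set.univ fun x : Fin n → ℝ => x ⬝ᵥ D *ᵥ x := by
  refine ⟨convex_univ, fun x _ y _ a b ha hb hab => ?_⟩
  have h : 0 ≤ (x - y) ⬝ᵥ D *ᵥ (x - y) := hD.dotProduct_mulVec_nonneg (x - y)
  have hxy := dotProduct_mulVec_comm_of_isSymm hD.transpose_eq x y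
  simp only [mulVec_add, mulVec_sub, mulVec_smul, dotProduct_add, dotProduct_sub,
    add_dotProduct, sub_dotProduct, dotProduct_smul, smul_dotProduct, smul_eq_mul] at h ⊢
  rw [hxy] at h ⊢
  obtain rfl : b = 1 - a := by linarith
  -- The convexity gap is `a * b` times the form at `x - y`.
  nlinarith [mul_nonneg (mul_nonneg ha hb) h]

theorem regionL_eq_iInter (S : Plant n m q) (α : ℝ) (N : ℕ) :
    regionL S α N = ⋂ lam ∈ Set.Ici (stageBound S N 1),
      {x | ((Real.sqrt α)⁻¹ • x) ⬝ᵥ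
        (stagePi S N 0 (stageBound S N 1) - stagePi S N 0 lam) *ᵥ ((Real.sqrt α)⁻¹ • x)
          ≤ lam - stageBound S N 1} := by
  ext x
  simp only [regionL, isMinOn_iff, objective, Set.mem_ofPred_eq, Set.mem_iInter, sub_mulVec,
    dotProduct_sub]
  refine forall₂_congr fun lam _ => ?_
  constructor <;> intro h <;> linarith

theorem isClosed_regionL (S : Plant n m q) (α : ℝ) (N : ℕ) : IsClosed (regionL S α N) := by
  rw [regionL_eq_iInter]
  refine isClosed_biInter fun lam _ => isClosed_le ?_ continuous_const
  exact (continuous_const_smul _).dotProduct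
    (continuous_const.matrix_mulVec (continuous_const_smul _))

theorem convex_regionL {S : Plant n m q}
    (hQ : S.Q.PosSemidef) (hR : S.R.PosDef) (hPf : S.Pf.PosSemidef)
    (hrange : LinearMap.range S.G.mulVecLin ≤ LinearMap.range S.B.mulVecLin)
    (hG : S.G.transpose * S.Pf * S.G ≠ 0) (α : ℝ) {N : ℕ} (hN : 1 ≤ N) :
    Convex ℝ (regionL S α N) := by
  rw [regionL_eq_iInter]
  refine convex_iInter₂ fun lam hlam => ?_
  have hD := stagePi_zero_sub_posSemidef hQ hR hPf hrange hG hN hlam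
  have hconv := (convexOn_dotProduct_mulVec hD).comp_linearMap
    ((Real.sqrt α)⁻¹ • LinearMap.id : (Fin n → ℝ) →ₗ[ℝ] (Fin n → ℝ))
  simpa using hconv.convex_le (lam - stageBound S N 1)

theorem zero_mem_regionL (S : Plant n m q) (α : ℝ) (N : ℕ) : 0 ∈ regionL S α N := by
  rw [regionL_eq_iInter]
  simp

end SiDAR

theorem proposition5 {n m q : ℕ} (S : SiDAR.Plant n m q)
    (hQ : S.Q.PosSemidef) (hR : S.R.PosDef) (hPf : S.Pf.PosSemidef)
    (hrange : LinearMap.range S.G.mulVecLin ≤ LinearMap.range S.B.mulVecLin)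
    (hG : S.G.transpose * S.Pf * S.G ≠ 0)
    (α : ℝ) (hα : 0 < α) :
    (0 : Fin n → ℝ) ∈ SiDAR.limitRegionL S α ∧
    (SiDAR.limitRegionL S α).Nonempty ∧
    IsClosed (SiDAR.limitRegionL S α) ∧
    Convex ℝ (SiDAR.limitRegionL S α) ∧
    IsOpen (SiDAR.limitRegionNL S α) := by
  have hzero : (0 : Fin n → ℝ) ∈ SiDAR.limitRegionL S α :=
    Set.mem_iInter₂.mpr fun N _ => SiDAR.zero_mem_regionL S α N
  have hclosed : IsClosed (SiDAR.limitRegionL S α) :=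
    isClosed_biInter fun N _ => SiDAR.isClosed_regionL S α N
  exact ⟨hzero, ⟨0, hzero⟩, hclosed,
    convex_iInter₂ fun N hN => SiDAR.convex_regionL hQ hR hPf hrange hG α hN,
    hclosed.isOpen_compl⟩
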